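/- A dimension function is a non-decreasing, right-continuous function $h:[0,\infty)\to[0,\infty)$ with $h(0)=0$ and $h(t)>0$ for all $t>0$. Write $h\prec x$ if $\lim_{x\to 0^+} x/h(x)=0$. For $E\subseteq\mathbb{R}$ let $$\mathcal{H}^h(E)=\lim_{\delta\to 0}\ \inf\Big\{\sum_i h(|U_i|) : E\subseteq\bigcup_{i\in\mathbb{N}} U_i,\ |U_i|\le\delta \text{ for all } i\Big\},$$ where $|U|$ is the diameter of $U$, be the Hausdorff measure associated with $h$. Let $h$ be a dimension function with $h\prec x$, and let $\{\pi_k\}_k$ be a countable set of planes in $\mathbb{R}^3$ through the origin (that is, two-dimensional linear subspaces of $\mathbb{R}^3$). Then there exists a compact set $E\subseteq\mathbb{R}$ with $\mathcal{H}^h(E)>0$ such that $$(x,y,z)\notin\pi_k\quad\text{for every } k \text{ and all pairwise distinct } x,y,z\in E.$$ -/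

import Mathlib

open scoped NNReal ENNReal Topology

/-- A dimension function: a non-decreasing right-continuous `h : [0,∞) → [0,∞)` with `h 0 = 0`
and `h t > 0` for `t > 0`. -/
structure IsDimensionFunction (h : ℝ≥0 → ℝ≥0) : Prop where
  map_zero : h 0 = 0
  pos : ∀ t, 0 < t → 0 < h t
  monotone : Monotone h
  rightContinuous : ∀ t, ContinuousWithinAt h (Set.Ici t) t

/-- The order on dimension functions: `h₂ ≺ h₁` iff `h₁ x / h₂ x → 0` as `x → 0⁺`. -/
def DimPrec (h₂ h₁ : ℝ≥0 → ℝ≥0) : Prop :=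
  Filter.Tendsto (fun x => h₁ x / h₂ x) (𝓝[>] 0) (𝓝 0)

/-- The Hausdorff measure associated with `h`: the limit, as `δ → 0`, of the infimum of
`∑ h (diam Uᵢ)` over countable coverings by sets of diameter at most `δ`. Only diameters
near `0` matter, so the value of the gauge at an infinite diameter is irrelevant. -/
noncomputable def gaugeHausdorffMeasure (h : ℝ≥0 → ℝ≥0) : MeasureTheory.Measure ℝ :=
  MeasureTheory.Measure.mkMetric (fun r : ℝ≥0∞ => (h r.toNNReal : ℝ≥0∞))

/-! Each plane lies in the kernel of a nonzero form `w`, and any three distinct reals lie in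
separated rational balls. This leaves countably many requirements (plane, balls), and stage `m` of a
Cantor construction settles the `m`-th. For `w`, confine each `w i * x i` near a lattice of step
`ε`, shifted by `ε / 2` for a single `i`: the sum stays near `ε * (ℤ + 1 / 2)`, hence nonzero
(`exists_spread_of_linear_form`). The proportion `c` kept does not depend on the scale `s`. So all
the `c m` are known in advance, and since `x / h x → 0` the scales can be taken so small that `h`
absorbs the product of the `c i` (`exists_isCompact_of_spread`). -/

/-- A set is `(s, c)`-spread if every interval of length `s / 2` contains the left endpoint of an
interval of length `c * s` contained in the set. -/
def IsSpread (s c : ℝ) (S : Set ℝ) : Prop :=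
  ∀ a, ∃ b ∈ Set.Icc a (a + s / 2), Set.Icc b (b + c * s) ⊆ S

/-! ### Gauge functions and mass distribution. -/

/-- A gauge that dominates the identity near `0` beats every linear function there. -/
lemma DimPrec.exists_le_mul {h : ℝ≥0 → ℝ≥0} (hh : IsDimensionFunction h)
    (hx : DimPrec h (fun x => x)) {C : ℝ} (hC : 0 < C) :
    ∃ σ : ℝ, 0 < σ ∧ ∀ d : ℝ≥0, 0 < d → (d : ℝ) ≤ σ → (d : ℝ) ≤ C * h d := by
  have h1 : ∀ᶠ x in 𝓝[>] (0 : ℝ≥0), x / h x < C.toNNReal :=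
    hx.eventually_lt_const (by simpa using hC)
  rw [eventually_nhdsWithin_iff, Metric.eventually_nhds_iff] at h1
  obtain ⟨e, he, h2⟩ := h1
  refine ⟨e / 2, by positivity, fun d hd hde => ?_⟩
  have h3 := h2 (y := d) (by rw [NNReal.dist_eq]; simp; linarith) hd
  rw [div_lt_iff₀ (hh.pos d hd), ← NNReal.coe_lt_coe] at h3
  simpa [hC.le] using h3.le

/-- The mass distribution principle for a parametrised set: if `φ` maps `[0, 1)` into `E` and its
inverse has modulus of continuity `C * h`, then `E` has positive gauge measure. -/
lemma gaugeHausdorffMeasure_pos {h : ℝ≥0 → ℝ≥0} (hmono : Monotone h) {E : Set ℝ} {C : ℝ≥0} (hC : C ≠ 0)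
    (φ : ℝ → ℝ) (hφE : ∀ t ∈ Set.Ico (0 : ℝ) 1, φ t ∈ E)
    (hφ : ∀ t ∈ Set.Ico (0 : ℝ) 1, ∀ u ∈ Set.Ico (0 : ℝ) 1,
      nndist t u ≤ C * h (nndist (φ t) (φ u))) :
    0 < gaugeHausdorffMeasure h E := by
  have key : (1 : ℝ≥0∞) ≤ C * gaugeHausdorffMeasure h E := by
    rw [gaugeHausdorffMeasure, MeasureTheory.Measure.mkMetric_apply]
    -- Any scale would do; `δ = 1` only serves to make the diameters finite.
    refine le_trans ?_ (mul_le_mul_right (le_iSup₂ (1 : ℝ≥0∞) one_pos) _)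
    simp_rw [ENNReal.mul_iInf_of_ne (ENNReal.coe_ne_zero.2 hC) ENNReal.coe_ne_top]
    refine le_iInf fun U => le_iInf fun hU => le_iInf fun hd => ?_
    rw [← ENNReal.tsum_mul_left]
    have h1 : Set.Ico (0 : ℝ) 1 ⊆ ⋃ n, (Set.Ico 0 1 ∩ φ ⁻¹' U n) := fun t ht => by
      obtain ⟨n, hn⟩ := Set.mem_iUnion.1 (hU (hφE t ht))
      exact Set.mem_iUnion.2 ⟨n, ht, hn⟩
    calc (1 : ℝ≥0∞) = MeasureTheory.volume (Set.Ico (0 : ℝ) 1) := by simp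
      _ ≤ ∑' n, MeasureTheory.volume (Set.Ico 0 1 ∩ φ ⁻¹' U n) :=
        (MeasureTheory.measure_mono h1).trans (MeasureTheory.measure_iUnion_le _)
      _ ≤ _ := ENNReal.tsum_le_tsum fun n => ?_
    refine (Real.volume_le_diam _).trans (Metric.ediam_le fun t ht u hu => ?_)
    rw [ciSup_pos ⟨_, ht.2⟩, edist_nndist]
    have hle : nndist (φ t) (φ u) ≤ (Metric.ediam (U n)).toNNReal := by
      rw [← ENNReal.coe_le_coe, ← edist_nndist,
        ENNReal.coe_toNNReal ((hd n).trans_lt ENNReal.one_lt_top).ne]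
      exact Metric.edist_le_ediam_of_mem ht.2 hu.2
    exact_mod_cast (hφ t ht.1 u hu.1).trans (mul_le_mul_right (hmono hle) _)
  refine pos_iff_ne_zero.2 fun h0 => ?_
  simp [h0] at key

/-! ### Spread sets avoiding the kernel of a linear form. -/

section Lattice

/-- A lattice of spacing `|δ|` meets every interval of length `|δ|`. -/
lemma exists_int_mul_add_mem_Icc {δ : ℝ} (hδ : δ ≠ 0) (o a : ℝ) :
    ∃ n : ℤ, δ * (n + o) ∈ Set.Icc a (a + |δ|) := by
  have e : δ * (a / δ) = a := by field_simp
  rcases hδ.lt_or_gt with h | h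
  · refine ⟨⌊a / δ - o⌋, ?_⟩
    have h1 := Int.floor_le (a / δ - o)
    have h2 := Int.lt_floor_add_one (a / δ - o)
    rw [abs_of_neg h]
    constructor <;> nlinarith
  · refine ⟨⌈a / δ - o⌉, ?_⟩
    have h1 := Int.le_ceil (a / δ - o)
    have h2 := Int.ceil_lt_add_one (a / δ - o)
    rw [abs_of_pos h]
    constructor <;> nlinarith

/-- For a nonzero linear form there are three spread sets on whose product it does not vanish. -/
lemma exists_spread_of_linear_form (w : Fin 3 → ℝ) (hw : w ≠ 0) :
    ∃ c : ℝ, 0 < c ∧ c ≤ 1 / 4 ∧ ∀ s : ℝ, 0 < s → ∃ G : Fin 3 → Set ℝ,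
      (∀ i, IsSpread s c (G i)) ∧ ∀ x : Fin 3 → ℝ, (∀ i, x i ∈ G i) → ∑ i, w i * x i ≠ 0 := by
  obtain ⟨j, hj⟩ := Function.ne_iff.1 hw
  obtain ⟨κ, hκ, hκw⟩ : ∃ κ : ℝ, 0 < κ ∧ ∀ i, w i ≠ 0 → κ ≤ |w i| := by
    let f : Fin 3 → ℝ := fun i => if w i = 0 then 1 else |w i|
    have hf : ∀ i, 0 < f i := fun i => by
      by_cases h : w i = 0 <;> simp [f, h]
    obtain ⟨i, hi⟩ := Finite.exists_min f
    refine ⟨f i, hf i, fun k hk => ?_⟩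
    simpa [f, hk] using hi k
  obtain ⟨K, hK, hwK⟩ : ∃ K : ℝ, 0 < K ∧ ∀ i, |w i| ≤ K := by
    obtain ⟨i, hi⟩ := Finite.exists_max fun i => |w i|
    exact ⟨|w i|, (abs_pos.2 hj).trans_le (hi j), hi⟩
  -- With `κ / (16 * K)`, `w i * x` varies by at most `ε / 8` over a length `c * s`.
  have hc : 0 < min (1 / 4) (κ / (16 * K)) := lt_min (by norm_num) (by positivity)
  refine ⟨_, hc, min_le_left _ _, fun s hs => ?_⟩
  set c := min (1 / 4) (κ / (16 * K))
  have hcK : K * c ≤ κ / 16 := by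
    have := min_le_right (1 / 4) (κ / (16 * K))
    calc K * c ≤ K * (κ / (16 * K)) := by gcongr
      _ = κ / 16 := by field_simp
  let o : Fin 3 → ℝ := Pi.single j (1 / 2)
  -- The spacing `ε / |w i|` is then at most `s / 2`, as spreadness demands.
  let ε : ℝ := s * κ / 2
  have hε : 0 < ε := by positivity
  refine ⟨fun i => {x | ∃ n : ℤ, |w i * x - ε * (n + o i)| ≤ ε / 8}, fun i a => ?_, ?_⟩
  · by_cases hi : w i = 0
    · refine ⟨a, ⟨le_rfl, by linarith⟩, fun x _ => ⟨0, ?_⟩⟩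
      have : i ≠ j := by rintro rfl; exact hj hi
      simp [hi, o, this]
      positivity
    · obtain ⟨n, hn1, hn2⟩ := exists_int_mul_add_mem_Icc (div_ne_zero hε.ne' hi) (o i) a
      have hδ : |ε / w i| ≤ s / 2 := by
        rw [abs_div, abs_of_pos hε, div_le_iff₀ (abs_pos.2 hi)]
        have := hκw i hi
        calc ε = s / 2 * κ := by simp only [ε]; ring
          _ ≤ _ := by gcongr
      refine ⟨_, ⟨hn1, by linarith⟩, fun x hx => ⟨n, ?_⟩⟩
      have e : w i * x - ε * (n + o i) = w i * (x - ε / w i * (n + o i)) := by field_simp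
      rw [e, abs_mul]
      have h1 : |x - ε / w i * (n + o i)| ≤ c * s := by
        rw [abs_le]; constructor <;> nlinarith [hx.1, hx.2, mul_pos hc hs]
      calc |w i| * |x - ε / w i * (n + o i)| ≤ K * (c * s) := by
            gcongr
            exact hwK i
        _ = K * c * s := by ring
        _ ≤ κ / 16 * s := by gcongr
        _ = ε / 8 := by simp only [ε]; ring
  · intro x hx h0
    choose n hn using hx
    have ho : o 0 + o 1 + o 2 = 1 / 2 := by
      have : ∑ i, o i = 1 / 2 := by simp [o]
      simpa [Fin.sum_univ_three] using this
    rw [Fin.sum_univ_three] at h0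
    have h0' := abs_le.1 (hn 0)
    have h1' := abs_le.1 (hn 1)
    have h2' := abs_le.1 (hn 2)
    -- Three errors of `ε / 8` stay below `ε / 2`, the distance from `0` to the shifted lattice.
    have hN : |ε * ((n 0 + n 1 + n 2 : ℤ) + 1 / 2 : ℝ)| ≤ 3 * (ε / 8) := by
      rw [← ho, abs_le]; push_cast
      constructor <;> linarith [h0'.1, h0'.2, h1'.1, h1'.2, h2'.1, h2'.2]
    rw [abs_mul, abs_of_pos hε] at hN
    have h3 : |((n 0 + n 1 + n 2 : ℤ) + 1 / 2 : ℝ)| ≤ 3 / 8 := by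
      by_contra! h
      nlinarith
    obtain ⟨h4, h5⟩ := abs_le.1 h3
    have h6 : ((n 0 + n 1 + n 2 : ℤ) : ℝ) < 0 := by linarith
    have h7 : (-1 : ℝ) < ((n 0 + n 1 + n 2 : ℤ) : ℝ) := by linarith
    have h8 : n 0 + n 1 + n 2 < 0 := by exact_mod_cast h6
    have h9 : -1 < n 0 + n 1 + n 2 := by exact_mod_cast h7
    omega

/-- A spread set none of whose points, taken in three separated balls, annihilate a nonzero linear
form. -/
lemma exists_spread_avoiding (w : Fin 3 → ℝ) (hw : w ≠ 0) (p : Fin 3 → ℝ) {q : ℝ} (hq : 0 < q)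
    (hp : ∀ i j, i ≠ j → 3 * q ≤ |p i - p j|) :
    ∃ c : ℝ, 0 < c ∧ c ≤ 1 / 4 ∧ ∃ ρ : ℝ, 0 < ρ ∧ ∀ s : ℝ, 0 < s → s ≤ ρ → ∃ S : Set ℝ,
      IsSpread s c S ∧ ∀ x : Fin 3 → ℝ, (∀ i, x i ∈ S) → (∀ i, |x i - p i| ≤ q) →
        ∑ i, w i * x i ≠ 0 := by
  obtain ⟨c, hc0, hc1, hG⟩ := exists_spread_of_linear_form w hw
  refine ⟨c, hc0, hc1, q / 2, by positivity, fun s hs hsq => ?_⟩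
  obtain ⟨G, hG1, hG2⟩ := hG s hs
  refine ⟨{x | ∀ i, |x - p i| ≤ q → x ∈ G i}, fun a => ?_,
    fun x hx hxp => hG2 x fun i => hx i i (hxp i)⟩
  have hcs : c * s ≤ 1 / 4 * s := by gcongr
  -- As `s ≤ q / 2`, this window meets at most one ball, so only one `G i` constrains it.
  by_cases h : ∃ i, ∃ y ∈ Set.Icc a (a + s), |y - p i| ≤ q
  · obtain ⟨i, y, hy, hyi⟩ := h
    obtain ⟨b, hb, hbG⟩ := hG1 i a
    refine ⟨b, hb, fun x hx k hk => ?_⟩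
    have hki : k = i := by
      by_contra hne
      have h1 := hp k i hne
      rw [abs_le] at hyi hk
      have : |p k - p i| < 3 * q := by
        rw [abs_lt]
        constructor <;> linarith [hx.1, hx.2, hb.1, hb.2, hy.1, hy.2, hyi.1, hyi.2, hk.1, hk.2]
      linarith
    exact hki ▸ hbG hx
  · push Not at h
    refine ⟨a, ⟨le_rfl, by linarith⟩, fun x hx k hk => ?_⟩
    exact absurd hk (not_le.2 (h k x ⟨hx.1, by linarith [hx.2]⟩))

end Lattice

/-! ### Cantor construction with prescribed scales. -/

section Cantor

/-- Left endpoints of the intervals of a Cantor-type construction: an interval of stage `m` is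
cut into `N m` cells of length `s m`, and `b m` maps the left endpoint of a cell to the left endpoint
of the interval of stage `m + 1` chosen in that cell. -/
noncomputable def cantorLeft (r₀ : ℝ) (N : ℕ → ℕ) (s : ℕ → ℝ) (b : ℕ → ℝ → ℝ) : ℕ → ℕ → ℝ
  | 0, k => k * r₀
  | m + 1, k => b m (cantorLeft r₀ N s b m (k / N m) + (k % N m : ℕ) * s m)

/-- The parameters of a Cantor-type construction. -/
structure CantorData where
  /-- length of the intervals of a stage -/
  r : ℕ → ℝ
  /-- number of children of an interval of a stage -/
  N : ℕ → ℕ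
  /-- length of the cells of a stage -/
  s : ℕ → ℝ
  /-- contraction from cells to intervals of the next stage -/
  c : ℕ → ℝ
  /-- choice of the child in a cell -/
  b : ℕ → ℝ → ℝ
  r_zero_pos : 0 < r 0
  two_le_N : ∀ m, 2 ≤ N m
  r_eq : ∀ m, r m = N m * s m
  r_succ : ∀ m, r (m + 1) = c m * s m
  c_pos : ∀ m, 0 < c m
  c_le : ∀ m, c m ≤ 1 / 4
  le_b : ∀ m x, x ≤ b m x
  b_le : ∀ m x, b m x ≤ x + s m / 2

namespace CantorData

variable (D : CantorData)

/-- Left endpoint of the `k`-th interval of stage `m`. -/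
noncomputable def left : ℕ → ℕ → ℝ := cantorLeft (D.r 0) D.N D.s D.b

/-- The `k`-th interval of stage `m`. -/
def interval (m k : ℕ) : Set ℝ := Set.Icc (D.left m k) (D.left m k + D.r m)

/-- The number of intervals of stage `m`. -/
def count (m : ℕ) : ℕ := ∏ i ∈ Finset.range m, D.N i

/-- The limit set. -/
def limitSet : Set ℝ := ⋂ m, ⋃ k ∈ Finset.range (D.count m), D.interval m k

lemma left_zero (k : ℕ) : D.left 0 k = k * D.r 0 := rfl

lemma left_succ (m k : ℕ) :
    D.left (m + 1) k = D.b m (D.left m (k / D.N m) + (k % D.N m : ℕ) * D.s m) := rfl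

lemma N_pos (m : ℕ) : 0 < D.N m := by have := D.two_le_N m; omega

lemma count_succ (m : ℕ) : D.count (m + 1) = D.count m * D.N m := Finset.prod_range_succ _ _

lemma count_pos (m : ℕ) : 0 < D.count m := Finset.prod_pos fun i _ => D.N_pos i

lemma r_pos (m : ℕ) : 0 < D.r m := by
  induction m with
  | zero => exact D.r_zero_pos
  | succ m ih =>
    rw [D.r_succ]
    rw [D.r_eq] at ih
    exact mul_pos (D.c_pos m) (pos_of_mul_pos_right ih (Nat.cast_nonneg _))

lemma s_pos (m : ℕ) : 0 < D.s m := by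
  have h := D.r_pos m
  rw [D.r_eq] at h
  exact pos_of_mul_pos_right h (Nat.cast_nonneg _)

lemma r_succ_le (m : ℕ) : D.r (m + 1) ≤ D.s m / 4 := by
  rw [D.r_succ]
  nlinarith [D.c_le m, D.s_pos m]

/-- The `N i` cancel: cutting more finely costs no total length. -/
lemma r_mul_count (m : ℕ) : D.r m * D.count m = (∏ i ∈ Finset.range m, D.c i) * D.r 0 := by
  induction m with
  | zero => simp [count]
  | succ m ih =>
    rw [Finset.prod_range_succ, mul_right_comm, ← ih, D.r_eq m, D.r_succ, count_succ]
    push_cast; ring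

lemma mul_s_le {m i : ℕ} (hi : i < D.N m) : (i : ℝ) * D.s m + D.s m ≤ D.r m := by
  have h : ((i + 1 : ℕ) : ℝ) ≤ D.N m := by exact_mod_cast hi
  rw [D.r_eq]
  push_cast at h
  nlinarith [D.s_pos m]

lemma interval_succ_subset (m k : ℕ) : D.interval (m + 1) k ⊆ D.interval m (k / D.N m) := by
  intro x hx
  simp only [interval, left_succ, Set.mem_Icc] at hx ⊢
  have h1 := D.le_b m (D.left m (k / D.N m) + (k % D.N m : ℕ) * D.s m)
  have h2 := D.b_le m (D.left m (k / D.N m) + (k % D.N m : ℕ) * D.s m)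
  have h3 := D.mul_s_le (Nat.mod_lt k (D.N_pos m))
  have h4 := D.r_succ_le m
  have h5 : 0 ≤ ((k % D.N m : ℕ) : ℝ) * D.s m := mul_nonneg (Nat.cast_nonneg _) (D.s_pos m).le
  constructor <;> linarith [hx.1, hx.2, D.s_pos m]

/-- Choosing a child shifts it by at most half a cell, so neighbouring children stay half a cell
apart. When `k` and `k + 1` have different parents, the first bound at stage `m` is needed. -/
lemma left_add_r_le (m k : ℕ) : D.left m k + D.r m ≤ D.left m (k + 1) ∧
    D.left (m + 1) k + D.s m / 2 ≤ D.left (m + 1) (k + 1) := by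
  have step : ∀ m, (∀ k, D.left m k + D.r m ≤ D.left m (k + 1)) → ∀ k,
      D.left (m + 1) k + D.s m / 2 ≤ D.left (m + 1) (k + 1) := by
    intro m hm k
    rw [left_succ, left_succ]
    have h1 := D.b_le m (D.left m (k / D.N m) + (k % D.N m : ℕ) * D.s m)
    have h2 := D.le_b m (D.left m ((k + 1) / D.N m) + ((k + 1) % D.N m : ℕ) * D.s m)
    have hlt := Nat.mod_lt k (D.N_pos m)
    rcases (show k % D.N m + 1 ≤ D.N m from hlt).lt_or_eq with h | h
    · have e1 : (k + 1) / D.N m = k / D.N m := by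
        rw [Nat.add_div (D.N_pos m), Nat.div_eq_of_lt (D.two_le_N m),
          Nat.mod_eq_of_lt (D.two_le_N m), if_neg (by omega), add_zero, add_zero]
      have e2 : (k + 1) % D.N m = k % D.N m + 1 := by
        rw [Nat.add_mod, Nat.mod_eq_of_lt (D.two_le_N m), Nat.mod_eq_of_lt h]
      rw [e1, e2] at h2 ⊢
      push_cast at h2 ⊢
      linarith
    · have e1 : (k + 1) / D.N m = k / D.N m + 1 := by
        rw [Nat.add_div (D.N_pos m), Nat.div_eq_of_lt (D.two_le_N m),
          Nat.mod_eq_of_lt (D.two_le_N m), if_pos (by omega)]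
      have h3 := hm (k / D.N m)
      have h4 := D.mul_s_le hlt
      have h5 : 0 ≤ (((k + 1) % D.N m : ℕ) : ℝ) * D.s m :=
        mul_nonneg (Nat.cast_nonneg _) (D.s_pos m).le
      rw [e1] at h2 ⊢
      linarith
  have all : ∀ m k, D.left m k + D.r m ≤ D.left m (k + 1) := by
    intro m
    induction m with
    | zero => intro k; simp only [left_zero]; push_cast; linarith
    | succ m ih =>
      intro k
      linarith [step m ih k, D.r_succ_le m, D.s_pos m]
  exact ⟨all m k, step m (all m) k⟩

lemma left_add_mul_le (m k j : ℕ) :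
    D.left (m + 1) k + j * (D.s m / 2) ≤ D.left (m + 1) (k + j) := by
  induction j with
  | zero => simp
  | succ j ih =>
    have := (D.left_add_r_le m (k + j)).2
    rw [← add_assoc]
    push_cast
    linarith

lemma isCompact_limitSet : IsCompact D.limitSet := by
  have h : ∀ m, IsCompact (⋃ k ∈ Finset.range (D.count m), D.interval m k) := fun m =>
    (Finset.range (D.count m)).isCompact_biUnion fun k _ => isCompact_Icc
  exact (h 0).of_isClosed_subset (isClosed_iInter fun m => (h m).isClosed) (Set.iInter_subset _ 0)

lemma limitSet_subset {m : ℕ} {S : Set ℝ} (hS : ∀ x, Set.Icc (D.b m x) (D.b m x + D.r (m + 1)) ⊆ S) :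
    D.limitSet ⊆ S := by
  intro x hx
  have h := Set.mem_iInter.1 hx (m + 1)
  simp only [Set.mem_iUnion] at h
  obtain ⟨k, -, hk⟩ := h
  exact hS _ hk

/-- The index at stage `m` of the interval that carries the parameter `t`. -/
noncomputable def index (t : ℝ) (m : ℕ) : ℕ := ⌊t * D.count m⌋₊

lemma index_zero {t : ℝ} (ht : t ∈ Set.Ico (0 : ℝ) 1) : D.index t 0 = 0 := by
  simp [index, count, ht.2]

/-- Makes the intervals carrying `t` a nested sequence. -/
lemma index_succ_div (t : ℝ) (m : ℕ) : D.index t (m + 1) / D.N m = D.index t m := by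
  have h : (D.N m : ℝ) ≠ 0 := by exact_mod_cast (D.N_pos m).ne'
  rw [index, index, ← Nat.floor_div_natCast, count_succ]
  congr 1
  push_cast
  field_simp

lemma exists_mem_interval (t : ℝ) : ∃ x, ∀ m, x ∈ D.interval m (D.index t m) := by
  have h := IsCompact.nonempty_iInter_of_sequence_nonempty_isCompact_isClosed
    (fun m => D.interval m (D.index t m))
    (fun m => by
      have := D.interval_succ_subset m (D.index t (m + 1))
      rwa [index_succ_div] at this)
    (fun m => Set.nonempty_Icc.2 (by linarith [D.r_pos m])) isCompact_Icc
    (fun m => isClosed_Icc)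
  obtain ⟨x, hx⟩ := h
  exact ⟨x, Set.mem_iInter.1 hx⟩

/-- The point of the limit set with parameter `t`. -/
noncomputable def point (t : ℝ) : ℝ := (D.exists_mem_interval t).choose

lemma point_mem_interval (t : ℝ) (m : ℕ) : D.point t ∈ D.interval m (D.index t m) :=
  (D.exists_mem_interval t).choose_spec m

lemma point_mem_limitSet {t : ℝ} (ht : t ∈ Set.Ico (0 : ℝ) 1) : D.point t ∈ D.limitSet := by
  refine Set.mem_iInter.2 fun m => Set.mem_biUnion ?_ (D.point_mem_interval t m)
  have h : (0 : ℝ) < D.count m := by exact_mod_cast D.count_pos m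
  rw [Finset.coe_range, Set.mem_Iio, index, Nat.floor_lt (mul_nonneg ht.1 h.le)]
  nlinarith [ht.2]

lemma two_pow_le_count (m : ℕ) : 2 ^ m ≤ D.count m := by
  simpa [count] using Finset.pow_card_le_prod (Finset.range m) D.N 2 fun i _ => D.two_le_N i

/-- Two parameters are separated at a first stage, and the distance of their points is bounded below
linearly with the constant of that stage. -/
lemma exists_sub_le {t u : ℝ} (ht : t ∈ Set.Ico (0 : ℝ) 1) (hu : u ∈ Set.Ico (0 : ℝ) 1)
    (htu : t < u) : ∃ m, D.point u - D.point t ≤ D.r m ∧ D.point t < D.point u ∧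
      (u - t) * ((∏ i ∈ Finset.range m, D.c i) * D.r 0) ≤ 8 * (D.point u - D.point t) := by
  have hex : ∃ m, D.index t m ≠ D.index u m := by
    obtain ⟨m, hm⟩ := pow_unbounded_of_one_lt (1 / (u - t)) (one_lt_two (α := ℝ))
    refine ⟨m, fun h => ?_⟩
    have hle : (2 : ℝ) ^ m ≤ D.count m := by exact_mod_cast D.two_pow_le_count m
    rw [div_lt_iff₀ (by linarith)] at hm
    have h1 := Nat.lt_floor_add_one (u * D.count m)
    have h2 := Nat.floor_le (mul_nonneg ht.1 (Nat.cast_nonneg (D.count m)))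
    simp only [index] at h
    rw [← h] at h1
    nlinarith
  classical
  obtain ⟨m, hm⟩ : ∃ m, Nat.find hex = m + 1 := by
    refine Nat.exists_eq_succ_of_ne_zero fun h0 => ?_
    have := Nat.find_spec hex
    rw [h0, D.index_zero ht, D.index_zero hu] at this
    exact this rfl
  have hne : D.index t (m + 1) ≠ D.index u (m + 1) := hm ▸ Nat.find_spec hex
  have heq : D.index t m = D.index u m := not_not.1 (Nat.find_min hex (by omega))
  have hM : (0 : ℝ) < D.count (m + 1) := by exact_mod_cast D.count_pos (m + 1)
  have hle : D.index t (m + 1) ≤ D.index u (m + 1) := Nat.floor_mono (by gcongr)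
  obtain ⟨j, hj⟩ := Nat.exists_eq_add_of_le hle
  have hj1 : (1 : ℝ) ≤ j := by
    have : 1 ≤ j := by omega
    exact_mod_cast this
  have ht0 := D.point_mem_interval t m
  have hu0 := D.point_mem_interval u m
  have ht1 := D.point_mem_interval t (m + 1)
  have hu1 := D.point_mem_interval u (m + 1)
  rw [← heq] at hu0
  rw [hj] at hu1
  have hl := D.left_add_mul_le m (D.index t (m + 1)) j
  have hr := D.r_succ_le m
  have hs := D.s_pos m
  -- Left endpoints differ by `j * s / 2`; the interval length costs at most `s / 4`, and `j ≥ 1`.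
  have hd : j * (D.s m / 4) ≤ D.point u - D.point t := by nlinarith [ht1.2, hu1.1]
  refine ⟨m, by linarith [ht0.1, hu0.2], by nlinarith, ?_⟩
  -- The floors differ by `j`, so the left side is below `j + 1 ≤ 2 * j`.
  have hcnt : (u - t) * D.count (m + 1) ≤ 2 * j := by
    have h1 := Nat.floor_le (mul_nonneg ht.1 hM.le)
    have h2 := Nat.lt_floor_add_one (u * D.count (m + 1))
    have h3 : ((⌊u * D.count (m + 1)⌋₊ : ℕ) : ℝ) = ⌊t * D.count (m + 1)⌋₊ + j := by
      exact_mod_cast hj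
    rw [h3] at h2
    linarith
  calc (u - t) * ((∏ i ∈ Finset.range m, D.c i) * D.r 0)
      = (u - t) * D.count (m + 1) * D.s m := by
        rw [← r_mul_count, D.r_eq m, count_succ]; push_cast; ring
    _ ≤ 2 * j * D.s m := by gcongr
    _ ≤ _ := by linarith

/-- The limit set has positive gauge measure when the lengths decrease fast enough. -/
lemma gaugeHausdorffMeasure_limitSet_pos {h : ℝ≥0 → ℝ≥0} (hmono : Monotone h)
    (hD : ∀ m, ∀ d : ℝ≥0, 0 < d → (d : ℝ) ≤ D.r m →
      (d : ℝ) ≤ (∏ i ∈ Finset.range m, D.c i) * h d) :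
    0 < gaugeHausdorffMeasure h D.limitSet := by
  have hr := D.r_zero_pos
  have key : ∀ t ∈ Set.Ico (0 : ℝ) 1, ∀ u ∈ Set.Ico (0 : ℝ) 1, t < u →
      nndist t u ≤ (8 / D.r 0).toNNReal * h (nndist (D.point t) (D.point u)) := by
    intro t ht u hu htu
    obtain ⟨m, h1, h2, h3⟩ := D.exists_sub_le ht hu htu
    have e : (nndist (D.point t) (D.point u) : ℝ) = D.point u - D.point t := by
      rw [coe_nndist, dist_comm, Real.dist_eq, abs_of_pos (by linarith)]
    have h4 := hD m (nndist (D.point t) (D.point u)) (by rw [← NNReal.coe_pos, e]; linarith)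
      (e ▸ h1)
    have hP : 0 < ∏ i ∈ Finset.range m, D.c i := Finset.prod_pos fun i _ => D.c_pos i
    rw [← NNReal.coe_le_coe, NNReal.coe_mul, Real.coe_toNNReal _ (by positivity), coe_nndist,
      dist_comm, Real.dist_eq, abs_of_pos (by linarith), div_mul_eq_mul_div, le_div_iff₀ hr]
    rw [e] at h4
    -- The product of the `c i` occurs in both estimates and cancels, leaving a constant free of
    -- `m`.
    refine le_of_mul_le_mul_left ?_ hP
    linarith
  refine gaugeHausdorffMeasure_pos hmono (C := (8 / D.r 0).toNNReal) (by simpa using hr) D.point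
    (fun t ht => D.point_mem_limitSet ht) fun t ht u hu => ?_
  rcases lt_trichotomy t u with h | rfl | h
  · exact key t ht u hu h
  · simp
  · rw [nndist_comm, nndist_comm (D.point t)]
    exact key u hu t ht h

end CantorData

/-- Given countably many properties of sets, each satisfied by spread sets at every small scale,
there is a compact set of positive gauge measure contained for each property in a set having it. -/
theorem exists_isCompact_of_spread {h : ℝ≥0 → ℝ≥0} (hh : IsDimensionFunction h)
    (hx : DimPrec h (fun x => x)) (Good : ℕ → Set ℝ → Prop)
    (hGood : ∀ m, ∃ c : ℝ, 0 < c ∧ c ≤ 1 / 4 ∧ ∃ ρ : ℝ, 0 < ρ ∧ ∀ s : ℝ, 0 < s → s ≤ ρ →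
      ∃ S : Set ℝ, IsSpread s c S ∧ Good m S) :
    ∃ E : Set ℝ, IsCompact E ∧ 0 < gaugeHausdorffMeasure h E ∧ ∀ m, ∃ S, Good m S ∧ E ⊆ S := by
  choose c hc0 hc1 ρ hρ S hS using hGood
  have hP : ∀ m, 0 < ∏ i ∈ Finset.range m, c i := fun m => Finset.prod_pos fun i _ => hc0 i
  choose σ hσ hσh using fun m => hx.exists_le_mul hh (hP m)
  -- `ρ m` makes the spread set available; `σ (m + 1)` already accounts for the loss `c m`.
  let τ : ℕ → ℝ := fun m => min (ρ m) (σ (m + 1))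
  have hτ : ∀ m, 0 < τ m := fun m => lt_min (hρ m) (hσ _)
  let N' : ℕ → ℝ → ℕ := fun m x => ⌈x / τ m⌉₊ + 2
  let r : ℕ → ℝ := fun m => Nat.rec (σ 0) (fun m x => c m * (x / N' m x)) m
  let s : ℕ → ℝ := fun m => r m / N' m (r m)
  have hN' : ∀ m x, (0 : ℝ) < N' m x := fun m x => by positivity
  have hr : ∀ m, 0 < r m := fun m => by
    induction m with
    | zero => exact hσ 0
    | succ m ih => exact mul_pos (hc0 m) (div_pos ih (hN' m _))
  have hs : ∀ m, 0 < s m := fun m => div_pos (hr m) (hN' m _)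
  have hsτ : ∀ m, s m ≤ τ m := fun m => by
    rw [div_le_comm₀ (hN' m _) (hτ m)]
    have := Nat.le_ceil (r m / τ m)
    simp only [N']; push_cast; linarith
  have hrσ : ∀ m, r m ≤ σ m := fun m => by
    cases m with
    | zero => exact le_rfl
    | succ m =>
      have h1 : s m ≤ σ (m + 1) := (hsτ m).trans (min_le_right _ _)
      have h2 : r (m + 1) = c m * s m := rfl
      nlinarith [hs m, hc1 m]
  choose b hb hbS using fun m x =>
    (hS m (s m) (hs m) ((hsτ m).trans (min_le_left _ _))).1 x
  let D : CantorData :=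
    { r := r, N := fun m => N' m (r m), s := s, c := c, b := b
      r_zero_pos := hr 0
      two_le_N := fun m => Nat.le_add_left _ _
      r_eq := fun m => (mul_div_cancel₀ _ (hN' m _).ne').symm
      r_succ := fun m => rfl
      c_pos := hc0
      c_le := hc1
      le_b := fun m x => (hb m x).1
      b_le := fun m x => (hb m x).2 }
  refine ⟨D.limitSet, D.isCompact_limitSet, D.gaugeHausdorffMeasure_limitSet_pos hh.monotone
    fun m d hd hdr => hσh m d hd (hdr.trans (hrσ m)), fun m => ⟨_, (hS m (s m) (hs m)
      ((hsτ m).trans (min_le_left _ _))).2, D.limitSet_subset (hbS m)⟩⟩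

end Cantor

/-! ### Normals and rational separation. -/

section Planes

/-- A plane is contained in the kernel of a nonzero linear form. -/
lemma exists_normal {π : Submodule ℝ (EuclideanSpace ℝ (Fin 3))} (hπ : Module.finrank ℝ π = 2) :
    ∃ w : Fin 3 → ℝ, w ≠ 0 ∧ ∀ v ∈ π, ∑ i, w i * v i = 0 := by
  have hne : πᗮ ≠ ⊥ := fun h => by
    rw [Submodule.orthogonal_eq_bot_iff] at h
    subst h
    rw [finrank_top, finrank_euclideanSpace_fin] at hπ
    omega
  obtain ⟨w, hw, hw0⟩ := Submodule.exists_mem_ne_zero_of_ne_bot hne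
  refine ⟨w, fun h => hw0 (by ext i; exact congrFun h i), fun v hv => ?_⟩
  have := (Submodule.mem_orthogonal π w).1 hw v hv
  simpa [PiLp.inner_apply] using this

/-- Three distinct reals lie in separated balls with rational data. -/
lemma exists_rat_separated {x : Fin 3 → ℝ} (hx : Function.Injective x) :
    ∃ (p : Fin 3 → ℚ) (q : ℚ), 0 < q ∧ (∀ i j, i ≠ j → 3 * (q : ℝ) ≤ |(p i : ℝ) - p j|) ∧
      ∀ i, |x i - p i| ≤ q := by
  obtain ⟨g, hg, hgx⟩ : ∃ g : ℝ, 0 < g ∧ ∀ i j, i ≠ j → g ≤ |x i - x j| := by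
    let f : Fin 3 × Fin 3 → ℝ := fun i => if i.1 = i.2 then 1 else |x i.1 - x i.2|
    obtain ⟨i, hi⟩ := Finite.exists_min f
    refine ⟨f i, ?_, fun k l hkl => by simpa [f, hkl] using hi (k, l)⟩
    by_cases h : i.1 = i.2
    · simp [f, h]
    · simpa [f, h, sub_eq_zero] using fun h' => h (hx h')
  -- Moving two points by `q` each leaves a gap of at least `g - 2 * q > 3 * q`.
  obtain ⟨q, hq0, hq⟩ := exists_rat_btwn (show (0 : ℝ) < g / 5 by positivity)
  have hp : ∀ i, ∃ p : ℚ, |x i - p| ≤ q := fun i => by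
    obtain ⟨p, h1, h2⟩ := exists_rat_btwn (show x i < x i + q by linarith)
    exact ⟨p, abs_le.2 ⟨by linarith, by linarith⟩⟩
  choose p hp using hp
  refine ⟨p, q, by exact_mod_cast hq0, fun i j hij => ?_, hp⟩
  have h1 := hgx i j hij
  have h2 : |x i - x j| ≤ |x i - p i| + |(p i : ℝ) - p j| + |x j - p j| := by
    rw [abs_sub_comm (x j)]
    refine le_trans (le_of_eq ?_) (abs_add_three _ _ _)
    congr 1; ring
  linarith [hp i, hp j]

end Planes

/-! ### Assembly over all planes and rational balls. -/

theorem mainTheorem4 (h : ℝ≥0 → ℝ≥0) (hh : IsDimensionFunction h)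
    (hx : DimPrec h (fun x => x))
    (P : Set (Submodule ℝ (EuclideanSpace ℝ (Fin 3)))) (hP : P.Countable)
    (hplane : ∀ π ∈ P, Module.finrank ℝ π = 2) :
    ∃ E : Set ℝ, IsCompact E ∧ 0 < gaugeHausdorffMeasure h E ∧
      ∀ π ∈ P, ∀ x ∈ E, ∀ y ∈ E, ∀ z ∈ E, x ≠ y → y ≠ z → x ≠ z →
        !₂[x, y, z] ∉ π := by
  obtain ⟨e, he⟩ := Set.countable_iff_exists_subset_range.1 hP
  obtain ⟨f, hf⟩ := exists_surjective_nat (ℕ × (Fin 3 → ℚ) × ℚ)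
  -- The range of `e` may exceed `P` and the balls may overlap; the premises make such requirements
  -- vacuous.
  let Good : ℕ → Set ℝ → Prop := fun m S =>
    Module.finrank ℝ (e (f m).1) = 2 → 0 < (f m).2.2 →
    (∀ i j, i ≠ j → 3 * ((f m).2.2 : ℝ) ≤ |((f m).2.1 i : ℝ) - (f m).2.1 j|) →
    ∀ v ∈ e (f m).1, (∀ i, v i ∈ S) → ¬ ∀ i, |v i - (f m).2.1 i| ≤ (f m).2.2
  obtain ⟨E, hE, hpos, hgood⟩ := exists_isCompact_of_spread hh hx Good fun m => by
    by_cases hm : Module.finrank ℝ (e (f m).1) = 2 ∧ 0 < (f m).2.2 ∧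
      (∀ i j, i ≠ j → 3 * ((f m).2.2 : ℝ) ≤ |((f m).2.1 i : ℝ) - (f m).2.1 j|)
    · obtain ⟨h1, h2, h3⟩ := hm
      obtain ⟨w, hw, hwv⟩ := exists_normal h1
      obtain ⟨c, hc0, hc1, ρ, hρ, H⟩ := exists_spread_avoiding w hw (fun i => (f m).2.1 i)
        (q := (f m).2.2) (by exact_mod_cast h2) h3
      refine ⟨c, hc0, hc1, ρ, hρ, fun s hs hsρ => ?_⟩
      obtain ⟨S, hS, hSw⟩ := H s hs hsρ
      exact ⟨S, hS, fun _ _ _ v hv hvS hvp => hSw (fun i => v i) hvS hvp (hwv v hv)⟩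
    · exact ⟨1 / 4, by norm_num, le_rfl, 1, one_pos, fun s hs _ => ⟨Set.univ,
        fun a => ⟨a, ⟨le_rfl, by linarith⟩, Set.subset_univ _⟩,
        fun h1 h2 h3 => absurd ⟨h1, h2, h3⟩ hm⟩⟩
  refine ⟨E, hE, hpos, fun π hπ x hxE y hyE z hzE hxy hyz hxz hmem => ?_⟩
  have hinj : Function.Injective ![x, y, z] := by
    intro i j hij
    fin_cases i <;> fin_cases j <;> simp_all
  obtain ⟨p, q, hq, hpq, hxp⟩ := exists_rat_separated hinj
  obtain ⟨n, rfl⟩ := he hπ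
  obtain ⟨m, hm⟩ := hf (n, p, q)
  obtain ⟨S, hS, hES⟩ := hgood m
  simp only [Good] at hS
  rw [hm] at hS
  refine hS (hplane _ hπ) hq hpq _ hmem (fun i => hES ?_) hxp
  fin_cases i
  · exact hxE
  · exact hyE
  · exact hzE
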